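/- Let $q=e^{2\pi i\tau}$, and let $V$ be a $k$-dimensional complex vector space of functions on the upper half-plane $\mathbb{H}$ that is modular invariant: for all $f\in V$ and $\begin{pmatrix}a&b\\c&d\end{pmatrix}\in SL(2,\mathbb{Z})$, the function $\tau\mapsto f\left(\frac{a\tau+b}{c\tau+d}\right)$ lies in $V$. Suppose that $V$ has a basis $f_1,\dots,f_k$ of holomorphic functions with expansions, convergent on $\mathbb{H}$, $$f_i(\tau)=q^{h_i}\sum_{n=0}^\infty a^{(i)}_n q^n,\qquad a^{(i)}_0\neq 0,\quad h_i\in\mathbb{Q},\quad h_1<h_2<\cdots<h_k,$$ so that $\mathrm{ord}_{i\infty}f_i=h_i$. Let $W_V$ and $W'_V$ be the Wronskian determinants, with respect to the derivation $q\frac{d}{dq}=\frac{1}{2\pi i}\frac{d}{d\tau}$, of $f_1,\dots,f_k$ and of $q\frac{d}{dq}f_1,\dots,q\frac{d}{dq}f_k$, respectively. Assume that (i) the quotient $W'_V/W_V$ is holomorphic on $\mathbb{H}$, i.e. there is a holomorphic function $Q$ on $\mathbb{H}$ with $Q\,W_V=W'_V$ (in particular, this holds with $Q=W'_V/W_V$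 if $W_V$ is nonvanishing on $\mathbb{H}$); (ii) there are an integer $r\ge\lfloor k/6\rfloor$ and basis elements $f_{i_0},\dots,f_{i_r}$ with $\mathrm{ord}_{i\infty}f_{i_j}=j$ for $j=0,\dots,r$. Then $W'_V/W_V$ vanishes identically, i.e. $Q=0$. If in addition $f_{i_0},\dots,f_{i_r}$ are the only basis elements $f_i$ whose $q$-powers are non-negative integers (that is, with $h_i\in\mathbb{Z}_{\ge 0}$), then there are constants $\lambda_0,\dots,\lambda_r,C\in\mathbb{C}$ such that $$\sum_{j=0}^r\lambda_j f_{i_j}(\tau)=C\neq 0\qquad\text{for all }\tau\in\mathbb{H}.$$ -/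

import Mathlib

open UpperHalfPlane hiding I
open scoped Manifold MatrixGroups

/-- A complex vector space `V` of functions on the upper half-plane is modular invariant if
`f ((a τ + b) / (c τ + d))` lies in `V` for all `f ∈ V` and all matrices in `SL(2, ℤ)`. -/
def IsModularInvariant (V : Submodule ℂ (ℍ → ℂ)) : Prop :=
  ∀ γ : SL(2, ℤ), ∀ f ∈ V, (fun τ : ℍ => f (γ • τ)) ∈ V

/-- `f(τ) = q ^ h * ∑ a n * q ^ n` on the whole upper half-plane, where
`q ^ s = exp (2 π i s τ)`. -/
def HasQExpansion (f : ℍ → ℂ) (h : ℚ) (a : ℕ → ℂ) : Prop :=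
  ∀ τ : ℍ, HasSum
    (fun n : ℕ => a n * Complex.exp (2 * Real.pi * Complex.I * ((h : ℂ) + n) * (τ : ℂ))) (f τ)

/-- `f` has a `q`-expansion with leading term a nonzero multiple of `q ^ h`, that is,
the order of `f` at `i∞` is `h`. -/
def HasCuspOrder (f : ℍ → ℂ) (h : ℚ) : Prop :=
  ∃ a : ℕ → ℂ, a 0 ≠ 0 ∧ HasQExpansion f h a

/-- The derivation `q d/dq = (2 π i)⁻¹ d/dτ` on functions on the upper half-plane. -/
noncomputable def qDeriv (f : ℍ → ℂ) : ℍ → ℂ :=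
  Derivative.normalizedDerivOfComplex f

/-- The Wronskian determinant of `f 0, …, f (k - 1)` for the derivation `q d/dq`. -/
noncomputable def qWronskian {k : ℕ} (f : Fin k → ℍ → ℂ) (τ : ℍ) : ℂ :=
  Matrix.det (Matrix.of fun i j : Fin k => (qDeriv^[(i : ℕ)] (f j)) τ)

open Complex Metric Filter Topology ModularForm Function

/-! Under the modular group, `W_V` and `W'_V` transform with weights `k(k-1)` and `k(k+1)` and the
same factor `det A`, so `Q` has weight `2k` (`slash_eq_of_mul_qWronskian_eq`). At the cusp, `W_V` is
`q^(∑ h i)` times a unit, its leading coefficient being a Vandermonde determinant in the distinct `h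
i` (`exists_qWronskian_qTwist`). Elimination among the series of orders `0, …, r` gives a
combination `C + O(q^(r+1))` with `C ≠ 0` (`exists_sum_pow_mul_eq`). Its derivative loses `C` and
may replace one column of `W'_V`, so `Q = O(q^(r+1))`. Since `2k < 12(r+1)`, dividing by `Δ^(r+1)`
leaves a form of negative weight, hence `Q = 0`. If the combination were not constant, its remainder
would have an order `n > r`, which is no `h i` under the extra hypothesis. The exponents of the
columns of `W'_V` would then be distinct and nonzero, so `W'_V ≠ 0`, against `Q = 0`. -/

lemma MDifferentiable.qDeriv {f : ℍ → ℂ} (hf : MDifferentiable 𝓘(ℂ) 𝓘(ℂ) f) :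
    MDifferentiable 𝓘(ℂ) 𝓘(ℂ) (qDeriv f) :=
  Derivative.normalizedDerivOfComplex_mdifferentiable hf

lemma MDifferentiable.qDeriv_iterate {f : ℍ → ℂ} (hf : MDifferentiable 𝓘(ℂ) 𝓘(ℂ) f) (n : ℕ) :
    MDifferentiable 𝓘(ℂ) 𝓘(ℂ) (_root_.qDeriv^[n] f) := by
  induction n with
  | zero => exact hf
  | succ n ih => rw [iterate_succ_apply']; exact ih.qDeriv

lemma qDeriv_sum {ι : Type*} (s : Finset ι) {f : ι → ℍ → ℂ}
    (hf : ∀ i ∈ s, MDifferentiable 𝓘(ℂ) 𝓘(ℂ) (f i)) :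
    qDeriv (∑ i ∈ s, f i) = ∑ i ∈ s, qDeriv (f i) := by
  ext z
  have h (i) (hi : i ∈ s) := UpperHalfPlane.mdifferentiableAt_iff.mp (hf i hi z)
  have : (∑ i ∈ s, f i) ∘ ofComplex = ∑ i ∈ s, f i ∘ ofComplex := by
    ext w; simp [Finset.sum_apply]
  simp only [qDeriv, Derivative.normalizedDerivOfComplex, this, Finset.sum_apply]
  rw [deriv_sum h, Finset.mul_sum]

lemma qDeriv_sum_smul {ι : Type*} [Fintype ι] (c : ι → ℂ) {f : ι → ℍ → ℂ}
    (hf : ∀ i, MDifferentiable 𝓘(ℂ) 𝓘(ℂ) (f i)) :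
    qDeriv (∑ i, c i • f i) = ∑ i, c i • qDeriv (f i) := by
  rw [qDeriv_sum _ fun i _ => (hf i).const_smul (c i)]
  exact Finset.sum_congr rfl fun i _ =>
    Derivative.normalizedDerivOfComplex_smul (c i) (f i) (hf i)

lemma qDeriv_iterate_sum_smul {ι : Type*} [Fintype ι] (c : ι → ℂ) {f : ι → ℍ → ℂ}
    (hf : ∀ i, MDifferentiable 𝓘(ℂ) 𝓘(ℂ) (f i)) (n : ℕ) :
    qDeriv^[n] (∑ i, c i • f i) = ∑ i, c i • qDeriv^[n] (f i) := by
  induction n with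
  | zero => rfl
  | succ n ih =>
    simp only [iterate_succ_apply', ih]
    exact qDeriv_sum_smul c fun i => (hf i).qDeriv_iterate n

/-! ### Wronskians -/

lemma MDifferentiable.qWronskian {k : ℕ} {f : Fin k → ℍ → ℂ}
    (hf : ∀ i, MDifferentiable 𝓘(ℂ) 𝓘(ℂ) (f i)) :
    MDifferentiable 𝓘(ℂ) 𝓘(ℂ) (qWronskian f) := by
  have h (i : Fin k) (j : Fin k) := UpperHalfPlane.mdifferentiable_iff.mp
    ((hf j).qDeriv_iterate i)
  rw [UpperHalfPlane.mdifferentiable_iff]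
  have : _root_.qWronskian f ∘ ofComplex = fun z => ∑ σ : Equiv.Perm (Fin k),
      ((Equiv.Perm.sign σ : ℤ) : ℂ) *
        ∏ i, ((_root_.qDeriv^[(σ i : ℕ)] (f i)) ∘ ofComplex) z := by
    ext z
    simp [_root_.qWronskian, Matrix.det_apply']
  rw [this]
  exact DifferentiableOn.fun_sum fun σ _ => (DifferentiableOn.fun_finsetProd fun i _ => h _ _).const_mul _

lemma qWronskian_sum_smul {k : ℕ} {f : Fin k → ℍ → ℂ}
    (hf : ∀ i, MDifferentiable 𝓘(ℂ) 𝓘(ℂ) (f i)) (A : Matrix (Fin k) (Fin k) ℂ) :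
    qWronskian (fun j => ∑ i, A i j • f i) = A.det • qWronskian f := by
  ext τ
  rw [Pi.smul_apply, smul_eq_mul, mul_comm]
  simp only [qWronskian]
  rw [← Matrix.det_mul]
  congr 1
  ext i j
  simp [qDeriv_iterate_sum_smul _ hf, Matrix.mul_apply, mul_comm]

lemma qWronskian_update_sum_smul {k : ℕ} {f : Fin k → ℍ → ℂ}
    (hf : ∀ i, MDifferentiable 𝓘(ℂ) 𝓘(ℂ) (f i)) (i₀ : Fin k) (c : Fin k → ℂ) :
    qWronskian (update f i₀ (∑ i, c i • f i)) = c i₀ • qWronskian f := by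
  ext τ
  simp only [qWronskian, Pi.smul_apply]
  rw [← Matrix.det_updateCol_sum]
  congr 1
  ext i j
  by_cases hj : j = i₀
  · subst hj
    simp [qDeriv_iterate_sum_smul _ hf]
  · simp [hj]

/-! ### Transformation of iterated derivatives under the modular group -/

lemma qDeriv_comp_smul {f : ℍ → ℂ} (hf : MDifferentiable 𝓘(ℂ) 𝓘(ℂ) f) (γ : SL(2, ℤ)) :
    qDeriv (fun τ => f (γ • τ)) =
      (fun τ : ℍ => denom γ τ ^ (-2 : ℤ)) * fun τ => qDeriv f (γ • τ) := by
  have h := Derivative.normalizedDerivOfComplex_SL_slash (k := 0) hf (γ := γ)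
  rw [ModularForm.SL_slash_def, ModularForm.SL_slash_def] at h
  simp only [neg_zero, zpow_zero, mul_one, Int.cast_zero, zero_mul] at h
  ext τ
  have := congrFun h τ
  simpa [qDeriv, mul_comm] using this

/-- The coefficient of `(q d/dq)^l f ∘ γ` in `(q d/dq)^i (f ∘ γ)`. -/
noncomputable def qDerivCoeff (γ : SL(2, ℤ)) : ℕ → ℕ → ℍ → ℂ
  | 0, 0 => 1
  | 0, _ + 1 => 0
  | _ + 1, 0 => 0
  | i + 1, l + 1 => qDeriv (qDerivCoeff γ i (l + 1)) +
      qDerivCoeff γ i l * fun τ : ℍ => denom γ τ ^ (-2 : ℤ)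

lemma qDeriv_const (c : ℂ) : qDeriv (fun _ => c) = 0 :=
  Derivative.normalizedDerivOfComplex_const c

lemma qDerivCoeff_of_lt (γ : SL(2, ℤ)) {i l : ℕ} (h : i < l) : qDerivCoeff γ i l = 0 := by
  induction i generalizing l with
  | zero => cases l with
    | zero => simp at h
    | succ l => rfl
  | succ i ih => cases l with
    | zero => simp at h
    | succ l =>
      rw [qDerivCoeff, ih (by lia), ih (by lia), zero_mul, add_zero]
      exact qDeriv_const 0

lemma qDerivCoeff_self (γ : SL(2, ℤ)) (i : ℕ) :
    qDerivCoeff γ i i = fun τ : ℍ => denom γ τ ^ (-2 * i : ℤ) := by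
  induction i with
  | zero => ext; simp [qDerivCoeff]
  | succ i ih =>
    rw [qDerivCoeff, ih, qDerivCoeff_of_lt γ (Nat.lt_succ_self i)]
    ext τ
    have : qDeriv 0 = 0 := qDeriv_const 0
    rw [this, zero_add, Pi.mul_apply, ← zpow_add₀ (denom_ne_zero _ τ)]
    congr 1
    push_cast
    ring

lemma qDeriv_qDerivCoeff_zero (γ : SL(2, ℤ)) (i : ℕ) : qDeriv (qDerivCoeff γ i 0) = 0 := by
  cases i with
  | zero => exact qDeriv_const 1
  | succ i => exact qDeriv_const 0

lemma mdifferentiable_qDerivCoeff (γ : SL(2, ℤ)) (i l : ℕ) :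
    MDifferentiable 𝓘(ℂ) 𝓘(ℂ) (qDerivCoeff γ i l) := by
  induction i generalizing l with
  | zero => cases l with
    | zero => exact mdifferentiable_const
    | succ l => exact mdifferentiable_const
  | succ i ih => cases l with
    | zero => exact mdifferentiable_const
    | succ l =>
      exact (ih _).qDeriv.add ((ih _).mul (mdifferentiable_denom_zpow _ _))

lemma MDifferentiable.comp_SL_smul {f : ℍ → ℂ} (hf : MDifferentiable 𝓘(ℂ) 𝓘(ℂ) f)
    (γ : SL(2, ℤ)) : MDifferentiable 𝓘(ℂ) 𝓘(ℂ) (fun τ => f (γ • τ)) :=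
  hf.comp (UpperHalfPlane.mdifferentiable_smul (g := (γ : GL (Fin 2) ℝ)) (by simp))

/-- The bound `n` is arbitrary because coefficients with `l > i` vanish; a common `n` lets all rows
of a Wronskian be written as one matrix product. -/
lemma qDeriv_iterate_comp_smul {f : ℍ → ℂ} (hf : MDifferentiable 𝓘(ℂ) 𝓘(ℂ) f) (γ : SL(2, ℤ))
    {i n : ℕ} (hi : i < n) :
    qDeriv^[i] (fun τ => f (γ • τ)) =
      ∑ l ∈ Finset.range n, qDerivCoeff γ i l * fun τ => (qDeriv^[l] f) (γ • τ) := by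
  induction i generalizing n with
  | zero =>
    rw [Finset.sum_eq_single 0]
    · ext; simp [qDerivCoeff]
    · intro l _ hl
      rw [qDerivCoeff_of_lt γ (Nat.pos_of_ne_zero hl), zero_mul]
    · simp; lia
  | succ i ih =>
    obtain ⟨n, rfl⟩ : ∃ m, n = m + 1 := ⟨n - 1, by lia⟩
    have hd (l : ℕ) := (hf.qDeriv_iterate l).comp_SL_smul γ
    have hc := mdifferentiable_qDerivCoeff γ i
    rw [iterate_succ_apply', ih (Nat.lt_of_succ_lt hi), qDeriv_sum _ fun l _ => (hc l).mul (hd l)]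
    have key (l : ℕ) : qDeriv (qDerivCoeff γ i l * fun τ => (qDeriv^[l] f) (γ • τ)) =
        qDeriv (qDerivCoeff γ i l) * (fun τ => (qDeriv^[l] f) (γ • τ)) +
        qDerivCoeff γ i l * (fun τ : ℍ => denom γ τ ^ (-2 : ℤ)) *
          fun τ => (qDeriv^[l + 1] f) (γ • τ) := by
      refine (Derivative.normalizedDerivOfComplex_mul _ _ (hc l) (hd l)).trans ?_
      have := qDeriv_comp_smul (hf.qDeriv_iterate l) γ
      simp only [iterate_succ_apply']
      simp only [qDeriv] at this ⊢
      rw [this, mul_assoc]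
    simp_rw [key]
    -- Shifting `l` matches the recursion; the unmatched ends vanish, since the `l = 0` coefficient
    -- is constant and the coefficient at `(i, n)` has `i < n`.
    rw [Finset.sum_add_distrib, Finset.sum_range_succ', Finset.sum_range_succ (n := n),
      Finset.sum_range_succ' (n := n), qDerivCoeff_of_lt γ (show i < n by lia),
      qDeriv_qDerivCoeff_zero]
    simp only [qDerivCoeff, zero_mul, add_zero, ← Finset.sum_add_distrib, add_mul]

lemma sum_neg_two_mul (k : ℕ) : ∑ i : Fin k, (-2 * (i : ℕ) : ℤ) = -(k * (k - 1)) := by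
  induction k with
  | zero => simp
  | succ k ih => rw [Fin.sum_univ_castSucc]; simp only [Fin.val_castSucc, ih]; simp; ring

lemma prod_zpow_eq_zpow_sum {ι : Type*} (s : Finset ι) {x : ℂ} (hx : x ≠ 0) (e : ι → ℤ) :
    ∏ i ∈ s, x ^ e i = x ^ ∑ i ∈ s, e i := by
  induction s using Finset.cons_induction with
  | empty => simp
  | cons a s ha ih => rw [Finset.prod_cons, Finset.sum_cons, ih, zpow_add₀ hx]

/-- The chain rule multiplies the Wronskian matrix by a triangular one with diagonal `denom ^ (-2
i)`. -/
lemma qWronskian_comp_smul {k : ℕ} {f : Fin k → ℍ → ℂ}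
    (hf : ∀ i, MDifferentiable 𝓘(ℂ) 𝓘(ℂ) (f i)) (γ : SL(2, ℤ)) :
    qWronskian (fun j τ => f j (γ • τ)) = qWronskian f ∣[(k * (k - 1) : ℤ)] γ := by
  ext τ
  rw [ModularForm.SL_slash_apply]
  have : ((Matrix.of fun i l : Fin k => qDerivCoeff γ i l τ).det) =
      denom γ τ ^ (-(k * (k - 1)) : ℤ) := by
    rw [Matrix.det_of_isLowerTriangular]
    · simp only [Matrix.of_apply, qDerivCoeff_self]
      rw [prod_zpow_eq_zpow_sum _ (denom_ne_zero _ τ), sum_neg_two_mul]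
    · intro i l h
      simp [qDerivCoeff_of_lt γ (show (i : ℕ) < l from h)]
  rw [← this, mul_comm]
  simp only [qWronskian]
  rw [← Matrix.det_mul]
  congr 1
  ext i j
  simp only [Matrix.of_apply, Matrix.mul_apply, qDeriv_iterate_comp_smul (hf j) γ i.isLt,
    Finset.sum_apply, Pi.mul_apply, Finset.sum_range]

/-- Derivatives of order at least one never involve `f ∘ γ` itself, so the block of the coefficient
matrix shifted by one suffices and is still triangular. -/
lemma qWronskian_qDeriv_comp_smul {k : ℕ} {f : Fin k → ℍ → ℂ}
    (hf : ∀ i, MDifferentiable 𝓘(ℂ) 𝓘(ℂ) (f i)) (γ : SL(2, ℤ)) :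
    qWronskian (fun j => qDeriv fun τ => f j (γ • τ)) =
      qWronskian (fun j => qDeriv (f j)) ∣[(k * (k + 1) : ℤ)] γ := by
  ext τ
  rw [ModularForm.SL_slash_apply]
  have : ((Matrix.of fun i l : Fin k => qDerivCoeff γ (i + 1) (l + 1) τ).det) =
      denom γ τ ^ (-(k * (k + 1)) : ℤ) := by
    rw [Matrix.det_of_isLowerTriangular]
    · simp only [Matrix.of_apply, qDerivCoeff_self]
      rw [prod_zpow_eq_zpow_sum _ (denom_ne_zero _ τ)]
      congr 1
      push_cast
      simp only [mul_add, Finset.sum_add_distrib, sum_neg_two_mul]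
      simp
      ring
    · intro i l h
      have : (i : ℕ) < l := h
      simp [qDerivCoeff_of_lt γ (show (i + 1 : ℕ) < l + 1 by lia)]
  rw [← this, mul_comm]
  simp only [qWronskian]
  rw [← Matrix.det_mul]
  congr 1
  ext i j
  have h := qDeriv_iterate_comp_smul (hf j) γ (Nat.succ_lt_succ i.isLt)
  rw [Finset.sum_range_succ'] at h
  simp only [Matrix.of_apply, Matrix.mul_apply, ← iterate_succ_apply, h, Pi.add_apply,
    Finset.sum_apply, Pi.mul_apply, Finset.sum_range, qDerivCoeff, Pi.zero_apply, zero_mul,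
    add_zero, Nat.succ_eq_add_one]

/-! ### Functions of the form `q ^ e * p(q)` -/

/-- The function `τ ↦ q ^ e * p(q)` with `q = exp (2 π i τ)`. -/
noncomputable def qTwist (e : ℂ) (p : ℂ → ℂ) (τ : ℍ) : ℂ :=
  exp (2 * Real.pi * I * e * τ) * p (Periodic.qParam 1 τ)

/-- The operator on power series corresponding to `q d/dq` on `q ^ e * p(q)`. -/
noncomputable def eulerOp (e : ℂ) (p : ℂ → ℂ) (q : ℂ) : ℂ := e * p q + q * deriv p q

lemma qParam_mem_ball (τ : ℍ) : Periodic.qParam 1 τ ∈ ball (0 : ℂ) 1 := by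
  simpa using Periodic.norm_qParam_lt_one one_pos τ.im_pos

lemma qParam_one_eq (z : ℂ) : Periodic.qParam 1 z = exp (2 * Real.pi * I * z) := by
  simp [Periodic.qParam]

lemma exists_qParam_eq {q : ℂ} (hq : q ∈ ball (0 : ℂ) 1) (hq0 : q ≠ 0) :
    ∃ τ : ℍ, Periodic.qParam 1 τ = q :=
  ⟨⟨_, Periodic.im_invQParam_pos_of_norm_lt_one one_pos (by simpa using hq) hq0⟩,
    Periodic.qParam_right_inv one_ne_zero hq0⟩

lemma DifferentiableOn.eulerOp {p : ℂ → ℂ} (hp : DifferentiableOn ℂ p (ball 0 1)) (e : ℂ) :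
    DifferentiableOn ℂ (eulerOp e p) (ball 0 1) :=
  (hp.const_mul e).add (differentiableOn_id.mul (hp.deriv isOpen_ball))

lemma DifferentiableOn.eulerOp_iterate {p : ℂ → ℂ} (hp : DifferentiableOn ℂ p (ball 0 1))
    (e : ℂ) (n : ℕ) : DifferentiableOn ℂ ((_root_.eulerOp e)^[n] p) (ball 0 1) := by
  induction n with
  | zero => exact hp
  | succ n ih => rw [iterate_succ_apply']; exact ih.eulerOp e

lemma eulerOp_zero (e : ℂ) (p : ℂ → ℂ) : eulerOp e p 0 = e * p 0 := by simp [eulerOp]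

lemma eulerOp_iterate_zero (e : ℂ) (p : ℂ → ℂ) (n : ℕ) :
    ((eulerOp e)^[n] p) 0 = e ^ n * p 0 := by
  induction n with
  | zero => simp
  | succ n ih => rw [iterate_succ_apply', eulerOp_zero, ih]; ring

lemma hasDerivAt_qTwist {p : ℂ → ℂ} (hp : DifferentiableOn ℂ p (ball 0 1)) (e : ℂ) (τ : ℍ) :
    HasDerivAt (qTwist e p ∘ ofComplex) (2 * Real.pi * I * qTwist e (eulerOp e p) τ) τ := by
  have h1 : HasDerivAt (fun z : ℂ => exp (2 * Real.pi * I * e * z))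
      (exp (2 * Real.pi * I * e * τ) * (2 * Real.pi * I * e)) τ := by
    simpa using ((hasDerivAt_id (τ : ℂ)).const_mul (2 * Real.pi * I * e)).cexp
  have h2 : HasDerivAt (fun z : ℂ => Periodic.qParam 1 z)
      (Periodic.qParam 1 τ * (2 * Real.pi * I)) τ := by
    simp only [qParam_one_eq]
    simpa using ((hasDerivAt_id (τ : ℂ)).const_mul (2 * Real.pi * I)).cexp
  have h3 := (hp.differentiableAt (isOpen_ball.mem_nhds (qParam_mem_ball τ))).hasDerivAt
  have h4 := h1.mul (h3.comp (τ : ℂ) h2)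
  have h5 : qTwist e p ∘ ofComplex =ᶠ[𝓝 (τ : ℂ)]
      (fun z => exp (2 * Real.pi * I * e * z)) * (p ∘ fun z => Periodic.qParam 1 z) := by
    filter_upwards [isOpen_upperHalfPlaneSet.mem_nhds τ.im_pos] with z hz
    simp [qTwist, ofComplex_apply_of_im_pos hz]
  refine (h4.congr_of_eventuallyEq h5).congr_deriv ?_
  simp only [qTwist, eulerOp, comp_apply]
  ring

lemma mdifferentiable_qTwist {p : ℂ → ℂ} (hp : DifferentiableOn ℂ p (ball 0 1)) (e : ℂ) :
    MDifferentiable 𝓘(ℂ) 𝓘(ℂ) (qTwist e p) := fun τ =>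
  UpperHalfPlane.mdifferentiableAt_iff.mpr (hasDerivAt_qTwist hp e τ).differentiableAt

lemma qDeriv_qTwist {p : ℂ → ℂ} (hp : DifferentiableOn ℂ p (ball 0 1)) (e : ℂ) :
    qDeriv (qTwist e p) = qTwist e (eulerOp e p) := by
  ext τ
  rw [qDeriv, Derivative.normalizedDerivOfComplex, (hasDerivAt_qTwist hp e τ).deriv,
    inv_mul_cancel_left₀ two_pi_I_ne_zero]

lemma qDeriv_iterate_qTwist {p : ℂ → ℂ} (hp : DifferentiableOn ℂ p (ball 0 1)) (e : ℂ) (n : ℕ) :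
    qDeriv^[n] (qTwist e p) = qTwist e ((eulerOp e)^[n] p) := by
  induction n with
  | zero => rfl
  | succ n ih =>
    rw [iterate_succ_apply', ih, qDeriv_qTwist (hp.eulerOp_iterate e n), iterate_succ_apply']

lemma qTwist_add_natCast (e : ℂ) (n : ℕ) (p : ℂ → ℂ) (τ : ℍ) :
    qTwist (e + n) p τ = qTwist e (fun q => q ^ n * p q) τ := by
  simp only [qTwist, qParam_one_eq, ← exp_nat_mul, ← mul_assoc, ← exp_add]
  congr 2
  ring

lemma qTwist_natCast (n : ℕ) (p : ℂ → ℂ) (τ : ℍ) :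
    qTwist n p τ = Periodic.qParam 1 τ ^ n * p (Periodic.qParam 1 τ) := by
  simp only [qTwist, qParam_one_eq, ← exp_nat_mul]
  congr 2
  ring

/-- The Wronskian of functions `q ^ (e j) * p j (q)` is `q ^ (∑ e j) * G(q)`, where `G(0)` is a
Vandermonde determinant times the product of the leading coefficients. -/
lemma exists_qWronskian_qTwist {k : ℕ} (e : Fin k → ℂ) {p : Fin k → ℂ → ℂ}
    (hp : ∀ j, DifferentiableOn ℂ (p j) (ball 0 1)) :
    ∃ G : ℂ → ℂ, DifferentiableOn ℂ G (ball 0 1) ∧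
      G 0 = (Matrix.vandermonde e).det * ∏ j, p j 0 ∧
      qWronskian (fun j => qTwist (e j) (p j)) = qTwist (∑ j, e j) G := by
  refine ⟨fun q => (Matrix.of fun i j : Fin k => ((eulerOp (e j))^[(i : ℕ)] (p j)) q).det,
    ?_, ?_, ?_⟩
  · simp only [Matrix.det_apply']
    exact DifferentiableOn.fun_sum fun σ _ =>
      (DifferentiableOn.fun_finsetProd fun i _ => (hp i).eulerOp_iterate _ _).const_mul _
  · simp only [eulerOp_iterate_zero]
    rw [← Matrix.det_transpose (Matrix.vandermonde e), mul_comm, ← Matrix.det_mul_row]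
    simp [mul_comm, Matrix.vandermonde, Matrix.of_apply]
  · ext τ
    simp only [qWronskian, qDeriv_iterate_qTwist (hp _)]
    simp only [qTwist, Finset.mul_sum, Finset.sum_mul, exp_sum]
    rw [← Matrix.det_mul_row]
    rfl

/-! ### Power series on the unit disc -/

lemma HasQExpansion.exists_qTwist {f : ℍ → ℂ} {h : ℚ} {a : ℕ → ℂ} (hf : HasQExpansion f h a) :
    ∃ p : ℂ → ℂ, DifferentiableOn ℂ p (ball 0 1) ∧ p 0 = a 0 ∧ f = qTwist h p := by
  have hs (τ : ℍ) : HasSum (fun n => a n * Periodic.qParam 1 τ ^ n)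
      (exp (-(2 * Real.pi * I * h * τ)) * f τ) := by
    refine ((hf τ).mul_left (exp (-(2 * Real.pi * I * h * τ)))).congr_fun fun n => ?_
    rw [qParam_one_eq, ← exp_nat_mul, mul_left_comm (exp _), ← exp_add]
    congr 2
    ring
  refine ⟨fun q => ∑' n, a n * q ^ n, ?_, ?_, ?_⟩
  · intro q hq
    -- Absolute convergence at the radius `r` dominates the series on the smaller disc around `0`
    -- containing `q`.
    obtain ⟨r, hqr, hr1⟩ := exists_between (show ‖q‖ < 1 by simpa using hq)
    have hr0 : 0 < r := (norm_nonneg q).trans_lt hqr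
    obtain ⟨τ, hτ⟩ := exists_qParam_eq (q := (r : ℂ)) (by simpa [abs_of_pos hr0] using hr1)
      (by exact_mod_cast hr0.ne')
    have hsum := (hs τ).summable.norm
    rw [hτ] at hsum
    have := differentiableOn_tsum_of_summable_norm (F := fun n (w : ℂ) => a n * w ^ n)
      (U := ball (0 : ℂ) r) hsum (fun n => by fun_prop) isOpen_ball (fun n w hw => by
        have : ‖w‖ ≤ r := (by simpa using hw : ‖w‖ < r).le
        simp only [norm_mul, norm_pow, norm_real, Real.norm_of_nonneg hr0.le]
        gcongr)
    exact (this.differentiableAt (isOpen_ball.mem_nhds (by simpa using hqr))).differentiableWithinAt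
  · simpa using tsum_eq_single (f := fun n => a n * (0 : ℂ) ^ n) 0 (fun n hn => by simp [hn])
  · ext τ
    rw [qTwist, (hs τ).tsum_eq, ← mul_assoc, ← exp_add]
    simp

lemma DifferentiableOn.exists_eq_zero_add_mul {p : ℂ → ℂ}
    (hp : DifferentiableOn ℂ p (ball 0 1)) :
    ∃ R : ℂ → ℂ, DifferentiableOn ℂ R (ball 0 1) ∧ ∀ q, p q = p 0 + q * R q := by
  refine ⟨dslope p 0, (Complex.differentiableOn_dslope (ball_mem_nhds 0 one_pos)).mpr hp,
    fun q => ?_⟩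
  have := sub_smul_dslope p 0 q
  simp only [sub_zero, smul_eq_mul] at this
  rw [this]
  ring

lemma DifferentiableOn.exists_eq_pow_mul {R : ℂ → ℂ} (hR : DifferentiableOn ℂ R (ball 0 1))
    (h0 : ¬ Set.EqOn R 0 (ball 0 1)) :
    ∃ (n : ℕ) (S : ℂ → ℂ), DifferentiableOn ℂ S (ball 0 1) ∧ S 0 ≠ 0 ∧
      ∀ q, R q = q ^ n * S q := by
  have hball := ball_mem_nhds (0 : ℂ) one_pos
  have hconn := (convex_ball (0 : ℂ) 1).isPreconnected
  have hR' := hR.analyticOnNhd isOpen_ball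
  obtain ⟨p, hp⟩ := hR' 0 (mem_ball_self one_pos)
  have hp0 : p ≠ 0 := by
    rintro rfl
    exact h0 (hR'.eqOn_zero_of_preconnected_of_eventuallyEq_zero hconn
      (mem_ball_self one_pos) hp.eventually_eq_zero)
  have hS (n : ℕ) : DifferentiableOn ℂ ((swap dslope 0)^[n] R) (ball 0 1) := by
    induction n with
    | zero => exact hR
    | succ n ih =>
      rw [iterate_succ_apply']
      exact (Complex.differentiableOn_dslope hball).mpr ih
  exact ⟨p.order, _, hS p.order, hp.iterate_dslope_fslope_ne_zero hp0, fun q => by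
    simpa using hp.eq_pow_order_mul_iterate_dslope q⟩

/-- Gaussian elimination for power series of orders `0, …, n`. -/
lemma exists_sum_pow_mul_eq {n : ℕ} {p : Fin (n + 1) → ℂ → ℂ}
    (hp : ∀ j, DifferentiableOn ℂ (p j) (ball 0 1)) (h0 : ∀ j, p j 0 ≠ 0) :
    ∃ (c : Fin (n + 1) → ℂ) (R : ℂ → ℂ), c 0 = 1 ∧ DifferentiableOn ℂ R (ball 0 1) ∧
      ∀ q, ∑ j, c j * (q ^ (j : ℕ) * p j q) = p 0 0 + q ^ (n + 1) * R q := by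
  induction n with
  | zero =>
    obtain ⟨R, hR, h⟩ := (hp 0).exists_eq_zero_add_mul
    exact ⟨1, R, rfl, hR, fun q => by simp [← h]⟩
  | succ n ih =>
    obtain ⟨c, R, hc, hR, h⟩ := ih (p := fun j => p j.castSucc) (fun j => hp _) (fun j => h0 _)
    -- Chosen so that adding `x` times the last series cancels the `q ^ (n + 1)` term.
    set x := -R 0 / p (Fin.last _) 0
    obtain ⟨S, hS, h'⟩ := (hR.add ((hp (Fin.last _)).const_mul x)).exists_eq_zero_add_mul
    refine ⟨Fin.snoc c x, S, ?_, hS, fun q => ?_⟩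
    · rw [← Fin.castSucc_zero, Fin.snoc_castSucc, hc]
    · have hq := h' q
      have hx : x * p (Fin.last _) 0 = - R 0 := div_mul_cancel₀ _ (h0 _)
      simp only [Pi.add_apply, hx] at hq
      rw [Fin.sum_univ_castSucc]
      simp only [Fin.snoc_castSucc, Fin.snoc_last, Fin.val_castSucc, Fin.val_last]
      rw [h q, Fin.castSucc_zero]
      linear_combination q ^ (n + 1) * hq

/-! ### Modular forms of level one vanishing to high order -/

/-- A level one modular form of weight `k < 12 n` that is `O(q ^ n)` at the cusp vanishes. -/
lemma eq_zero_of_slash_eq_of_isBigO {k : ℤ} {n : ℕ} (hkn : k < 12 * n) {Q : ℍ → ℂ}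
    (hQ : MDifferentiable 𝓘(ℂ) 𝓘(ℂ) Q) (hslash : ∀ γ : SL(2, ℤ), Q ∣[k] γ = Q)
    (hO : Q =O[atImInfty] fun τ => Periodic.qParam 1 τ ^ n) : Q = 0 := by
  have hΔ (γ : SL(2, ℤ)) : ModularForm.discriminant ∣[(12 : ℤ)] γ = ModularForm.discriminant :=
    SlashInvariantForm.slash_action_generators_SL2Z discriminant_S_invariant
      discriminant_T_invariant γ
  have hinv (γ : SL(2, ℤ)) : (fun τ => Q τ / ModularForm.discriminant τ ^ n) ∣[k - 12 * n] γ =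
      fun τ => Q τ / ModularForm.discriminant τ ^ n := by
    ext τ
    have h1 := congrFun (hslash γ) τ
    have h2 := congrFun (hΔ γ) τ
    have hd := denom_ne_zero (γ : GL (Fin 2) ℝ) τ
    rw [ModularForm.SL_slash_apply] at h1 h2 ⊢
    rw [← h1, ← h2, neg_sub, sub_eq_add_neg, zpow_add₀ hd, mul_pow, ← zpow_natCast (_ ^ (-12 : ℤ)),
      ← zpow_mul, neg_mul, zpow_neg _ (12 * (n : ℤ))]
    have := discriminant_ne_zero (γ • τ)
    have := zpow_ne_zero (12 * (n : ℤ)) hd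
    field_simp
  -- `Δ` has no zeros on `ℍ` and `q = O(Δ)` at the cusp, so the quotient is a modular form of
  -- negative weight.
  let F : ModularForm 𝒮ℒ (k - 12 * n) :=
    { toFun := fun τ => Q τ / ModularForm.discriminant τ ^ n
      slash_action_eq' := fun _ ⟨γ, hγ⟩ => hγ ▸ hinv γ
      holo' := hQ.div (CuspForm.discriminant.holo'.pow n)
        fun τ => pow_ne_zero _ (discriminant_ne_zero τ)
      bdd_at_cusps' := by
        intro c hc
        rw [Subgroup.IsArithmetic.isCusp_iff_isCusp_SL2Z] at hc
        rw [OnePoint.isBoundedAt_iff_forall_SL2Z hc]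
        intro γ _
        rw [hinv γ, IsBoundedAtImInfty, BoundedAtFilter]
        refine (Asymptotics.div_isBoundedUnder_of_isBigO (hO.trans ?_)).isBigO_one ℝ
        refine Asymptotics.IsBigO.pow (Asymptotics.IsBigO.trans (.of_bound 1 ?_)
          exp_isBigO_discriminant) n
        filter_upwards with τ
        simp [Periodic.norm_qParam] }
  have hF := ModularFormClass.levelOne_neg_weight_eq_zero (by lia) F
  ext τ
  have h : Q τ / ModularForm.discriminant τ ^ n = 0 := congrFun hF τ
  simpa [discriminant_ne_zero] using h

/-! ### Limits at the cusp and the quotient of Wronskians -/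

lemma tendsto_comp_qParam {G : ℂ → ℂ} (hG : DifferentiableOn ℂ G (ball 0 1)) :
    Tendsto (fun τ : ℍ => G (Periodic.qParam 1 τ)) atImInfty (𝓝 (G 0)) :=
  (hG.differentiableAt (ball_mem_nhds 0 one_pos)).continuousAt.tendsto.comp
    (qParam_tendsto_atImInfty one_pos)

lemma qTwist_ne_zero {G : ℂ → ℂ} (hG : DifferentiableOn ℂ G (ball 0 1)) (h0 : G 0 ≠ 0) (e : ℂ) :
    qTwist e G ≠ 0 := by
  intro h
  obtain ⟨τ, hτ⟩ := ((tendsto_comp_qParam hG).eventually_ne h0).exists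
  have := congrFun h τ
  simp [qTwist, hτ] at this

/-- If `V` is modular invariant and `Q * W_V = W'_V`, then `Q` is invariant of weight `2 k`. -/
lemma slash_eq_of_mul_qWronskian_eq {k : ℕ} {V : Submodule ℂ (ℍ → ℂ)} (hV : IsModularInvariant V)
    (f : Module.Basis (Fin k) ℂ V) (hol : ∀ i, MDifferentiable 𝓘(ℂ) 𝓘(ℂ) (f i : ℍ → ℂ))
    (hW : qWronskian (fun i => (f i : ℍ → ℂ)) ≠ 0)
    {Q : ℍ → ℂ} (hQ_hol : MDifferentiable 𝓘(ℂ) 𝓘(ℂ) Q)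
    (hQ : Q * qWronskian (fun i => (f i : ℍ → ℂ)) = qWronskian (fun i => qDeriv (f i : ℍ → ℂ)))
    (γ : SL(2, ℤ)) : Q ∣[(2 * k : ℤ)] γ = Q := by
  set g : Fin k → ℍ → ℂ := fun i => f i
  obtain ⟨A, hA⟩ : ∃ A : Matrix (Fin k) (Fin k) ℂ,
      ∀ j, (fun τ => g j (γ • τ)) = ∑ i, A i j • g i := by
    refine ⟨fun i j => f.repr ⟨_, hV γ (f j) (f j).2⟩ i, fun j => ?_⟩
    have := congrArg Subtype.val (f.sum_repr ⟨_, hV γ (f j) (f j).2⟩)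
    rw [Submodule.coe_sum] at this
    exact this.symm
  have hD (j) : qDeriv (fun τ => g j (γ • τ)) = ∑ i, A i j • qDeriv (g i) := by
    rw [hA j, qDeriv_sum_smul _ hol]
  have h1 : qWronskian g ∣[(k * (k - 1) : ℤ)] γ = A.det • qWronskian g := by
    rw [← qWronskian_comp_smul hol, ← qWronskian_sum_smul hol]
    exact congrArg _ (funext hA)
  have h2 : qWronskian (fun i => qDeriv (g i)) ∣[(k * (k + 1) : ℤ)] γ =
      A.det • qWronskian (fun i => qDeriv (g i)) := by
    rw [← qWronskian_qDeriv_comp_smul hol, ← qWronskian_sum_smul fun i => (hol i).qDeriv]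
    exact congrArg _ (funext hD)
  have hdet : A.det ≠ 0 := by
    intro h
    rw [h, zero_smul] at h1
    apply hW
    have := congrArg (· ∣[(k * (k - 1) : ℤ)] γ⁻¹) h1
    simpa [← SlashAction.slash_mul] using this
  have h3 := ModularForm.mul_slash_SL2 (2 * k) (k * (k - 1)) γ Q (qWronskian g)
  rw [hQ, show (2 * k + k * (k - 1) : ℤ) = k * (k + 1) by ring, h1, h2, ← hQ,
    mul_smul_comm, smul_right_inj hdet] at h3
  -- Holomorphic functions on `ℍ` have no zero divisors, so `W_V` cancels even where it has zeros.
  have h4 : (Q ∣[(2 * k : ℤ)] γ - Q) * qWronskian g = 0 := by rw [sub_mul, ← h3, sub_self]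
  have hslash : MDifferentiable 𝓘(ℂ) 𝓘(ℂ) (Q ∣[(2 * k : ℤ)] γ) := by
    rw [ModularForm.SL_slash_def]
    exact (hQ_hol.comp_SL_smul γ).mul (mdifferentiable_denom_zpow _ _)
  exact sub_eq_zero.mp (((mul_eq_zero_iff (hslash.sub hQ_hol) (.qWronskian hol)).mp h4).resolve_right
    hW)

theorem theorem2p2 (k : ℕ) (V : Submodule ℂ (ℍ → ℂ)) (hV : IsModularInvariant V)
    (f : Module.Basis (Fin k) ℂ V)
    (hol : ∀ i, MDifferentiable 𝓘(ℂ) 𝓘(ℂ) (f i : ℍ → ℂ))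
    (h : Fin k → ℚ) (h_mono : StrictMono h)
    (h_ord : ∀ i, HasCuspOrder (f i : ℍ → ℂ) (h i))
    -- the quotient `Q = W'_V / W_V` is holomorphic on the upper half-plane
    (Q : ℍ → ℂ) (hQ_hol : MDifferentiable 𝓘(ℂ) 𝓘(ℂ) Q)
    (hQ : ∀ τ, Q τ * qWronskian (fun i => (f i : ℍ → ℂ)) τ
      = qWronskian (fun i => qDeriv (f i : ℍ → ℂ)) τ)
    (r : ℕ) (hr : k / 6 ≤ r) (idx : Fin (r + 1) → Fin k)
    (h_idx : ∀ j, h (idx j) = ((j : ℕ) : ℚ)) :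
    (∀ τ, Q τ = 0) ∧
    ((∀ i, (∃ n : ℕ, h i = (n : ℚ)) → i ∈ Set.range idx) →
      ∃ (c : Fin (r + 1) → ℂ) (C : ℂ), C ≠ 0 ∧
        ∀ τ : ℍ, ∑ j, c j * (f (idx j) : ℍ → ℂ) τ = C) := by
  replace hQ : Q * qWronskian (fun i => (f i : ℍ → ℂ)) =
    qWronskian (fun i => qDeriv (f i : ℍ → ℂ)) := funext hQ
  choose a ha0 ha using h_ord
  choose p hp hpa hfp using fun i => (ha i).exists_qTwist
  have hp0 (i) : p i 0 ≠ 0 := hpa i ▸ ha0 i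
  have h_inj : Injective fun i => (h i : ℂ) := Rat.cast_injective.comp h_mono.injective
  have hidx_inj : Injective idx := fun i j hij => by
    have := h_idx i
    rw [hij, h_idx j] at this
    exact Fin.ext (by exact_mod_cast this.symm)
  -- the Wronskian of the basis
  obtain ⟨G, hG, hG0, hWG⟩ := exists_qWronskian_qTwist (fun i => (h i : ℂ)) hp
  simp only [← hfp] at hWG
  replace hG0 : G 0 ≠ 0 := hG0 ▸ mul_ne_zero (Matrix.det_vandermonde_ne_zero_iff.mpr h_inj)
    (Finset.prod_ne_zero_iff.mpr fun i _ => hp0 i)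
  -- a combination of basis elements of the form `C + O(q ^ (r + 1))`
  obtain ⟨c, R, hc, hR, hcR⟩ := exists_sum_pow_mul_eq (p := fun j => p (idx j)) (fun j => hp _)
    (fun j => hp0 _)
  set i₀ := idx 0
  have hF (τ : ℍ) : ∑ j, c j * (f (idx j) : ℍ → ℂ) τ =
      p i₀ 0 + Periodic.qParam 1 τ ^ (r + 1) * R (Periodic.qParam 1 τ) := by
    rw [← hcR]
    refine Finset.sum_congr rfl fun j _ => ?_
    rw [hfp, h_idx, ← qTwist_natCast]
    simp
  -- Needed twice: with `n = r + 1`, `S = R` for the bound on `Q`, and later with the exact order of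
  -- the remainder.
  have hDF {n : ℕ} {S : ℂ → ℂ} (hS : DifferentiableOn ℂ S (ball 0 1))
      (hRS : ∀ τ : ℍ, Periodic.qParam 1 τ ^ (r + 1) * R (Periodic.qParam 1 τ) =
        Periodic.qParam 1 τ ^ n * S (Periodic.qParam 1 τ)) :
      ∑ j, c j • qDeriv (f (idx j) : ℍ → ℂ) = qTwist n (eulerOp n S) := by
    rw [← qDeriv_qTwist hS, ← qDeriv_sum_smul _ fun j => hol (idx j)]
    have : ∑ j, c j • (f (idx j) : ℍ → ℂ) = (fun _ => p i₀ 0) + qTwist n S := by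
      ext τ
      simp [hF, hRS, qTwist_natCast]
    rw [this]
    refine (Derivative.normalizedDerivOfComplex_add _ _ mdifferentiable_const
      (mdifferentiable_qTwist hS n)).trans ?_
    rw [Derivative.normalizedDerivOfComplex_const, zero_add]
    rfl
  -- the Wronskian of the derivatives, after replacing the column of `i₀`
  have hW' {n : ℕ} {S : ℂ → ℂ} (hS : DifferentiableOn ℂ S (ball 0 1))
      (hRS : ∀ τ : ℍ, Periodic.qParam 1 τ ^ (r + 1) * R (Periodic.qParam 1 τ) =
        Periodic.qParam 1 τ ^ n * S (Periodic.qParam 1 τ)) :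
      ∃ G' : ℂ → ℂ, DifferentiableOn ℂ G' (ball 0 1) ∧
        G' 0 = (Matrix.vandermonde (update (fun i => (h i : ℂ)) i₀ n)).det *
          ∏ i, update (fun i => h i * p i 0) i₀ (n * S 0) i ∧
        qWronskian (fun i => qDeriv (f i : ℍ → ℂ)) = qTwist (∑ i, (h i : ℂ) + n) G' := by
    have hcol : qWronskian (fun i => qDeriv (f i : ℍ → ℂ)) =
        qWronskian (update (fun i => qDeriv (f i : ℍ → ℂ)) i₀ (qTwist n (eulerOp n S))) := by
      -- Extending `c` by zero gives a column operation; `c 0 = 1` leaves the determinant unchanged.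
      have := qWronskian_update_sum_smul (fun i => (hol i).qDeriv) i₀ (extend idx c 0)
      rw [hidx_inj.extend_apply, hc, one_smul] at this
      rw [← this, ← hDF hS hRS]
      congr 2
      exact (Fintype.sum_of_injective idx hidx_inj _ _
        (fun i hi => by rw [extend_apply' _ _ _ hi, Pi.zero_apply, zero_smul])
        fun j => by rw [hidx_inj.extend_apply]).symm
    obtain ⟨G', hG', hG'0, hWG'⟩ := exists_qWronskian_qTwist (update (fun i => (h i : ℂ)) i₀ n)
      (p := update (fun i => eulerOp (h i) (p i)) i₀ (eulerOp n S)) (by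
        intro j
        by_cases hj : j = i₀
        · subst hj; simpa using hS.eulerOp _
        · simpa [hj] using (hp j).eulerOp _)
    refine ⟨G', hG', ?_, ?_⟩
    · rw [hG'0]
      congr 1
      refine Finset.prod_congr rfl fun i _ => ?_
      by_cases hi : i = i₀
      · subst hi; simp [eulerOp_zero]
      · simp [hi, eulerOp_zero]
    -- The replaced exponent is `h i₀ = 0`, so the sum grows by exactly `n`.
    · have hsum : ∑ i, update (fun i => (h i : ℂ)) i₀ n i = ∑ i, (h i : ℂ) + n := by
        rw [Finset.sum_update_of_mem (Finset.mem_univ i₀),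
          ← Finset.sum_sdiff (Finset.subset_univ {i₀}), Finset.sum_singleton]
        simp [i₀, h_idx, add_comm]
      rw [← hsum, ← hWG', hcol]
      congr 1
      ext1 i
      by_cases hi : i = i₀
      · subst hi; simp
      · simp [hi, hfp i, qDeriv_qTwist (hp i)]
  have hQ0 : Q = 0 := by
    refine eq_zero_of_slash_eq_of_isBigO (k := 2 * k) (n := r + 1) (by lia) hQ_hol
      (slash_eq_of_mul_qWronskian_eq hV f hol (hWG ▸ qTwist_ne_zero hG hG0 _) hQ_hol hQ) ?_
    obtain ⟨G', hG', -, hWG'⟩ := hW' hR fun _ => rfl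
    have hlim := (tendsto_comp_qParam hG').div (tendsto_comp_qParam hG) hG0
    refine ((hlim.isBigO_one ℂ).mul (Asymptotics.isBigO_refl
      (fun τ : ℍ => Periodic.qParam 1 τ ^ (r + 1)) atImInfty)).congr' ?_ (by simp)
    filter_upwards [(tendsto_comp_qParam hG).eventually_ne hG0] with τ hτ
    have := congrFun hQ τ
    rw [hWG', hWG, Pi.mul_apply, qTwist_add_natCast, qTwist, qTwist, mul_left_comm] at this
    have := mul_left_cancel₀ (exp_ne_zero _) this
    simp only [Pi.div_apply]
    rw [div_mul_eq_mul_div, div_eq_iff hτ, this, mul_comm]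
  refine ⟨congrFun hQ0, fun hrange => ⟨c, p i₀ 0, hp0 _, fun τ => ?_⟩⟩
  suffices Set.EqOn R 0 (ball 0 1) by simp [hF, this (qParam_mem_ball τ)]
  by_contra hR0
  obtain ⟨s, S, hS, hS0, hRS⟩ := hR.exists_eq_pow_mul hR0
  obtain ⟨G', hG', hG'0, hWG'⟩ := hW' (n := r + 1 + s) hS fun τ => by rw [hRS, pow_add _ (r + 1), mul_assoc]
  -- Every natural number among the `h i` is attained on `idx`, hence at most `r`.
  have hne (i) : (h i : ℂ) ≠ (r + 1 + s : ℕ) := by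
    intro hi
    have hi' : h i = (r + 1 + s : ℕ) := by exact_mod_cast hi
    obtain ⟨j, rfl⟩ := hrange i ⟨_, hi'⟩
    rw [h_idx] at hi'
    have : (j : ℕ) = r + 1 + s := by exact_mod_cast hi'
    lia
  refine qTwist_ne_zero hG' ?_ _ (hWG'.symm.trans (by rw [← hQ, hQ0, zero_mul]))
  rw [hG'0]
  refine mul_ne_zero (Matrix.det_vandermonde_ne_zero_iff.mpr ?_)
    (Finset.prod_ne_zero_iff.mpr fun i _ => ?_)
  · intro i j hij
    by_cases hi : i = i₀ <;> by_cases hj : j = i₀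
    · rw [hi, hj]
    · simp only [hi, hj, update_self, ne_eq, not_false_eq_true, update_of_ne] at hij
      exact absurd hij.symm (hne j)
    · simp only [hi, hj, update_self, ne_eq, not_false_eq_true, update_of_ne] at hij
      exact absurd hij (hne i)
    · simp only [hi, hj, ne_eq, not_false_eq_true, update_of_ne] at hij
      exact h_inj hij
  · by_cases hi : i = i₀
    · subst hi
      rw [update_self]
      exact mul_ne_zero (by exact_mod_cast (by lia)) hS0
    · rw [update_of_ne hi]
      -- Only `i₀` has exponent `0`, so differentiation keeps the other leading terms.
      refine mul_ne_zero (fun h0 => hi (h_inj ?_)) (hp0 i)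
      simp [h0, i₀, h_idx]
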